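/- Let $d,m$ be natural numbers and let $A\in\{0,\star\}^{d\times d}$, $B\in\{0,\star\}^{d\times m}$ be sparsity matrices (each entry is either a fixed zero or an independent free real parameter $\star$). A pair $(A,B)$ is called structurally controllable if one can assign real values to the $\star$-entries of $A$ and $B$ so that the resulting real linear system $\dot x=A'x+B'u$ is controllable, i.e. every initial state can be steered to every final state in finite time by a continuous input. Let $G(A)$ be the digraph with vertices $v_1,\dots,v_d$ and an edge $(v_j,v_i)$ whenever $A_{ij}\neq 0$. A strongly connected component of $G(A)$ is a maximal strongly connected subgraph (a single vertex counts as strongly connected), and it is a source strongly connected component if no edge enters it from a vertex of another strongly connected component. Let $\Gamma(A)$ be the undirected bipartite graph with parts $\{v_1^1,\dots,v_d^1\}$ and $\{v_1^2,\dots,v_d^2\}$ in which $v_j^1$ and $v_i^2$ are joined whenever $A_{ij}\ne 0$. For a sparsity matrix $N$ let $\|N\|_0$ be its number of nonzero (that is, $\star$) entries. Assume that $\Gamma(A)$ has a perfect matching and that $(A,B)$ is structurally controllable. Let $\mathcal K$ be the set of all $B'\in\{0,\star\}^{d\times m}$ such that $B'_{ij}=0$ whenever $B_{ij}=0$ and $(A,B')$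 is structurally controllable. If $B^*\in\mathcal K$ satisfies $\|B^*\|_0\le\|B'\|_0$ for all $B'\in\mathcal K$, then $\|B^*\|_0=q$, where $q$ is the number of source strongly connected components of $G(A)$. -/

import Mathlib

namespace StructuralControl

/-- An entry of a sparsity matrix: a fixed zero, or a free parameter. -/
inductive Entry : Type
  | zero : Entry
  | free : Entry

instance : Zero Entry := ⟨Entry.zero⟩

/-- A sparsity matrix: every entry is either a fixed zero or a free parameter. -/
abbrev SparsityMatrix (n k : ℕ) : Type := Matrix (Fin n) (Fin k) Entry

/-- `R` is a numerical realization of `N`: real values are assigned to the free parameters of `N`,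
the fixed zeros stay zero. -/
def IsRealization {n k : ℕ} (N : SparsityMatrix n k) (R : Matrix (Fin n) (Fin k) ℝ) : Prop :=
  ∀ i j, N i j = 0 → R i j = 0

/-- Controllability of the linear time-invariant system `x' = A x + B u`: every initial state can
be steered to every final state in finite time by a continuous input. -/
def Controllable {d m : ℕ} (A : Matrix (Fin d) (Fin d) ℝ) (B : Matrix (Fin d) (Fin m) ℝ) : Prop :=
  ∀ x₀ x₁ : Fin d → ℝ, ∃ T : ℝ, 0 < T ∧ ∃ (u : ℝ → Fin m → ℝ) (x : ℝ → Fin d → ℝ),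
    ContinuousOn u (Set.Icc 0 T) ∧
    (∀ t ∈ Set.Icc 0 T,
      HasDerivWithinAt x (A.mulVec (x t) + B.mulVec (u t)) (Set.Icc 0 T) t) ∧
    x 0 = x₀ ∧ x T = x₁

/-- Structural controllability: some numerical realization is controllable. -/
def StructurallyControllable {d m : ℕ} (A : SparsityMatrix d d) (B : SparsityMatrix d m) : Prop :=
  ∃ (A' : Matrix (Fin d) (Fin d) ℝ) (B' : Matrix (Fin d) (Fin m) ℝ),
    IsRealization A A' ∧ IsRealization B B' ∧ Controllable A' B'

/-- The digraph `G(A)` on the state vertices: an edge from `v_j` to `v_i` iff `A i j ≠ 0`. -/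
def stateDigraph {d : ℕ} (A : SparsityMatrix d d) : Digraph (Fin d) where
  Adj j i := A i j ≠ 0

/-- The bipartite graph `Γ(A)`: `Sum.inl j` is the vertex `v_j^1`, `Sum.inr i` is the vertex
`v_i^2`, and they are joined iff `A i j ≠ 0`. -/
def bipartiteGraph {d : ℕ} (A : SparsityMatrix d d) : SimpleGraph (Fin d ⊕ Fin d) where
  Adj x y := ∃ i j, A i j ≠ 0 ∧
    ((x = Sum.inl j ∧ y = Sum.inr i) ∨ (x = Sum.inr i ∧ y = Sum.inl j))
  symm := ⟨by
    rintro x y ⟨i, j, h, h' | h'⟩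
    · exact ⟨i, j, h, Or.inr ⟨h'.2, h'.1⟩⟩
    · exact ⟨i, j, h, Or.inl ⟨h'.2, h'.1⟩⟩⟩
  loopless := ⟨by
    rintro x ⟨i, j, _, ⟨h₁, h₂⟩ | ⟨h₁, h₂⟩⟩ <;> simp [h₁] at h₂⟩

/-- `Γ(A)` has a perfect matching. -/
def HasPerfectMatching {d : ℕ} (A : SparsityMatrix d d) : Prop :=
  ∃ M : (bipartiteGraph A).Subgraph, M.IsPerfectMatching

/-- The subgraph of `G` induced on the nonempty vertex set `S` is strongly connected: any two
vertices of `S` are joined, in both directions, by a (possibly trivial) directed walk inside `S`. -/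
def IsStronglyConnectedOn {V : Type*} (G : Digraph V) (S : Set V) : Prop :=
  S.Nonempty ∧ ∀ v ∈ S, ∀ w ∈ S,
    Relation.ReflTransGen (fun a b => a ∈ S ∧ b ∈ S ∧ G.Adj a b) v w

/-- Strongly connected components, given by their vertex sets. -/
def IsSCC {V : Type*} (G : Digraph V) (S : Set V) : Prop :=
  Maximal (IsStronglyConnectedOn G) S

/-- Source strongly connected components: no edge enters from another component. -/
def IsSSCC {V : Type*} (G : Digraph V) (S : Set V) : Prop :=
  IsSCC G S ∧ ∀ S', IsSCC G S' → S' ≠ S → ∀ v ∈ S', ∀ w ∈ S, ¬ G.Adj v w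

/-- The number of source strongly connected components. -/
noncomputable def numSSCC {V : Type*} (G : Digraph V) : ℕ :=
  {S : Set V | IsSSCC G S}.ncard

/-- The number of nonzero entries of a sparsity matrix. -/
noncomputable def nnz {n k : ℕ} (N : SparsityMatrix n k) : ℕ :=
  {p : Fin n × Fin k | N p.1 p.2 ≠ 0}.ncard

/-- The locations of the fixed zeros of a sparsity matrix. -/
def zeroLocations {n k : ℕ} (N : SparsityMatrix n k) : Set (Fin n × Fin k) :=
  {p | N p.1 p.2 = 0}

/-- The admissible input matrices: those with at least the fixed zeros of `B` that keep the
system structurally controllable. -/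
def feasible {d m : ℕ} (A : SparsityMatrix d d) (B : SparsityMatrix d m) :
    Set (SparsityMatrix d m) :=
  {B' | zeroLocations B ⊆ zeroLocations B' ∧ StructurallyControllable A B'}

/-- `Bstar` minimizes the number of nonzero entries over the admissible input matrices. -/
def SolvesSparsest {d m : ℕ} (A : SparsityMatrix d d) (B Bstar : SparsityMatrix d m) : Prop :=
  Bstar ∈ feasible A B ∧ IsMinOn nnz (feasible A B) Bstar

end StructuralControl

/-! Lower bound: a source component that receives no input evolves autonomously, so from the origin
it never moves (`not_controllable_of_forall_zero`). Hence every admissible matrix has a nonzero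
entry in a row of each source component, and distinct components use distinct rows. Upper bound:
keep one such entry of `Bstar` per source component. By minimality of `Bstar` it is enough that the
resulting matrix is still structurally controllable. Every vertex is reachable from a source
component, hence from an input, and a perfect matching is a permutation σ with arcs j → σ j,
covering all vertices by disjoint cycles. Linking the cycles by arcs into a forest rooted at inputs
and giving them distinct positive weights yields an explicit realization that passes the Hautus test
(`CycleForest.hautus`). Controllability in the sense of trajectories then follows from Hautus ⇒
Kalman ⇒ steering (`kalman_of_hautus`, `controllable_of_kalman`). -/

namespace StructuralControl

/-! ### Strong components, source components and the matching permutation. -/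

open Relation

/-- The vertices joined to `v` by directed walks in both directions. -/
def mutuallyReachable {V : Type*} (G : Digraph V) (v : V) : Set V :=
  {w | ReflTransGen G.Adj v w ∧ ReflTransGen G.Adj w v}

theorem mem_mutuallyReachable_self {V : Type*} (G : Digraph V) (v : V) :
    v ∈ mutuallyReachable G v :=
  ⟨.refl, .refl⟩

theorem IsStronglyConnectedOn.reachable {V : Type*} {G : Digraph V} {S : Set V}
    (hS : IsStronglyConnectedOn G S) {v w : V} (hv : v ∈ S) (hw : w ∈ S) :
    ReflTransGen G.Adj v w :=
  ReflTransGen.mono (fun _ _ h => h.2.2) _ _ (hS.2 v hv w hw)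

theorem IsStronglyConnectedOn.subset_mutuallyReachable {V : Type*} {G : Digraph V} {S : Set V}
    (hS : IsStronglyConnectedOn G S) {v : V} (hv : v ∈ S) : S ⊆ mutuallyReachable G v :=
  fun _ hw => ⟨hS.reachable hv hw, hS.reachable hw hv⟩

theorem isStronglyConnectedOn_mutuallyReachable {V : Type*} (G : Digraph V) (v : V) :
    IsStronglyConnectedOn G (mutuallyReachable G v) := by
  refine ⟨⟨v, mem_mutuallyReachable_self G v⟩, fun a ha b hb => ?_⟩
  have key : ∀ c, ReflTransGen G.Adj a c → ReflTransGen G.Adj c b →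
      ReflTransGen (fun x y => x ∈ mutuallyReachable G v ∧ y ∈ mutuallyReachable G v ∧ G.Adj x y)
        a c := by
    intro c hac
    induction hac with
    | refl => exact fun _ => .refl
    | @tail x y hax hxy ih =>
      intro hyb
      have hxb : ReflTransGen G.Adj x b := .head hxy hyb
      exact (ih hxb).tail ⟨⟨ha.1.trans hax, hxb.trans hb.2⟩,
        ⟨ha.1.trans (hax.tail hxy), hyb.trans hb.2⟩, hxy⟩
  exact key b (ha.2.trans hb.1) .refl

theorem isSCC_mutuallyReachable {V : Type*} (G : Digraph V) (v : V) :
    IsSCC G (mutuallyReachable G v) :=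
  ⟨isStronglyConnectedOn_mutuallyReachable G v, fun _ hT hle =>
    hT.subset_mutuallyReachable (hle (mem_mutuallyReachable_self G v))⟩

theorem IsSCC.eq_mutuallyReachable {V : Type*} {G : Digraph V} {S : Set V} (hS : IsSCC G S)
    {v : V} (hv : v ∈ S) : S = mutuallyReachable G v :=
  hS.eq_of_subset (isStronglyConnectedOn_mutuallyReachable G v)
    (hS.1.subset_mutuallyReachable hv)

theorem IsSCC.eq_of_mem {V : Type*} {G : Digraph V} {S T : Set V} (hS : IsSCC G S)
    (hT : IsSCC G T) {v : V} (hvS : v ∈ S) (hvT : v ∈ T) : S = T :=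
  (hS.eq_mutuallyReachable hvS).trans (hT.eq_mutuallyReachable hvT).symm

theorem IsSSCC.mem_of_adj {V : Type*} {G : Digraph V} {S : Set V} (hS : IsSSCC G S) {v w : V}
    (hw : w ∈ S) (hvw : G.Adj v w) : v ∈ S := by
  by_contra hv
  refine hS.2 _ (isSCC_mutuallyReachable G v) ?_ v (mem_mutuallyReachable_self G v) w hw hvw
  rintro rfl
  exact hv (mem_mutuallyReachable_self G v)

/-- Among the ancestors of `v`, one whose own ancestor set is minimal lies in a source component: an
arc entering its component would start at a vertex with no more ancestors, hence at a mutually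
reachable one. -/
theorem exists_isSSCC_reachable {V : Type*} [Finite V] (G : Digraph V) (v : V) :
    ∃ S, IsSSCC G S ∧ ∀ w ∈ S, ReflTransGen G.Adj w v := by
  obtain ⟨w, hw, hmin⟩ := Set.Finite.exists_minimalFor
    (fun w => {a | ReflTransGen G.Adj a w}) {w | ReflTransGen G.Adj w v} (Set.toFinite _)
    ⟨v, .refl⟩
  refine ⟨mutuallyReachable G w, ⟨isSCC_mutuallyReachable G w, ?_⟩, fun a ha => ha.2.trans hw⟩
  intro T hT hne a ha b hb hab
  have haw : ReflTransGen G.Adj a w := .head hab hb.2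
  have hwa : ReflTransGen G.Adj w a :=
    hmin (haw.trans hw) (fun c (hc : ReflTransGen G.Adj c a) => hc.trans haw)
      (ReflTransGen.refl : ReflTransGen G.Adj w w)
  exact hne (hT.eq_of_mem (isSCC_mutuallyReachable G w) ha ⟨hwa, haw⟩)

theorem exists_perm_of_hasPerfectMatching {d : ℕ} {A : SparsityMatrix d d}
    (hA : HasPerfectMatching A) : ∃ σ : Equiv.Perm (Fin d), ∀ j, A (σ j) j ≠ 0 := by
  obtain ⟨M, hM⟩ := hA
  have h : ∀ j, ∃ i, M.Adj (Sum.inl j) (Sum.inr i) ∧ A i j ≠ 0 := by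
    intro j
    obtain ⟨y, hy, -⟩ := hM.1 (hM.2 (Sum.inl j))
    obtain ⟨i, j', hij, ⟨h₁, h₂⟩ | ⟨h₁, h₂⟩⟩ := M.adj_sub hy
    · cases h₁; subst h₂
      exact ⟨i, hy, hij⟩
    · cases h₁
  choose f hf hAf using h
  have hinj : Function.Injective f := by
    intro j k hjk
    have h₁ := (hf j).symm
    have h₂ := (hf k).symm
    rw [← hjk] at h₂
    exact Sum.inl_injective (hM.1.eq_of_adj_left h₁ h₂)
  exact ⟨Equiv.ofBijective f (Finite.injective_iff_bijective.1 hinj), hAf⟩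

end StructuralControl
-- From the Hautus condition to steering by continuous inputs.
namespace StructuralControl

open Matrix

/-- A pair satisfying the Popov–Belevitch–Hautus condition satisfies the Kalman condition. -/
theorem kalman_of_hautus {d m : ℕ} {A : Matrix (Fin d) (Fin d) ℝ} {B : Matrix (Fin d) (Fin m) ℝ}
    (h : ∀ (μ : ℂ) (v : Fin d → ℂ), v ᵥ* A.map Complex.ofReal = μ • v →
      v ᵥ* B.map Complex.ofReal = 0 → v = 0)
    (w : Fin d → ℝ) (hw : ∀ k : ℕ, w ᵥ* (A ^ k * B) = 0) : w = 0 := by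
  set A' : Matrix (Fin d) (Fin d) ℂ := A.map Complex.ofReal with hA'
  set B' : Matrix (Fin d) (Fin m) ℂ := B.map Complex.ofReal with hB'
  let V : Submodule ℂ (Fin d → ℂ) := ⨅ k : ℕ, LinearMap.ker (vecMulLinear (A' ^ k * B'))
  have hV : ∀ v, v ∈ V ↔ ∀ k : ℕ, v ᵥ* (A' ^ k * B') = 0 := by
    intro v; simp [V, Submodule.mem_iInf]
  have hinv : ∀ v ∈ V, vecMulLinear A' v ∈ V := by
    intro v hv
    rw [hV] at hv ⊢
    intro k
    rw [vecMulLinear_apply, vecMul_vecMul, ← Matrix.mul_assoc, ← pow_succ']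
    exact hv (k + 1)
  -- `V` is invariant under `A'`, so if nonzero it contains a complex eigenvector, and that
  -- eigenvector is killed by `B'` (the case k = 0).
  have hbot : V = ⊥ := by
    by_contra hne
    have : Nontrivial V := Submodule.nontrivial_iff_ne_bot.2 hne
    obtain ⟨μ, hμ⟩ := Module.End.exists_eigenvalue ((vecMulLinear A').restrict hinv)
    obtain ⟨v, hv⟩ := hμ.exists_hasEigenvector
    have h₁ : (v : Fin d → ℂ) ᵥ* A' = μ • (v : Fin d → ℂ) := congrArg Subtype.val hv.apply_eq_smul
    have h₂ : (v : Fin d → ℂ) ᵥ* B' = 0 := by simpa using (hV _).1 v.2 0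
    exact hv.2 (Subtype.ext (h μ v h₁ h₂))
  have hmem : (Complex.ofReal ∘ w) ∈ V := by
    rw [hV]
    intro k
    have hAk : A' ^ k * B' = (A ^ k * B).map Complex.ofReal := by
      have := Matrix.map_mul (L := A ^ k) (M := B) (f := Complex.ofRealHom)
      have h2 := Matrix.map_pow A Complex.ofRealHom k
      exact (this.trans (by rw [h2]; rfl)).symm
    ext j
    have := congrFun (hw k) j
    rw [hAk]
    simp only [vecMul, dotProduct, Function.comp, Matrix.map_apply, Pi.zero_apply] at this ⊢
    exact_mod_cast this
  rw [hbot, Submodule.mem_bot] at hmem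
  ext i
  simpa using congrFun hmem i

section Kalman

open NormedSpace Set

variable {E : Type*} [NormedAddCommGroup E] [NormedSpace ℝ E] [CompleteSpace E]

theorem hasDerivAt_exp_smul_apply (L : E →L[ℝ] E) (x : E) (t : ℝ) :
    HasDerivAt (fun s : ℝ => exp (s • L) x) (L (exp (t • L) x)) t :=
  (hasDerivAt_exp_smul_const' L t).clm_apply (hasDerivAt_const t x) |>.congr_deriv (by simp)

theorem continuous_exp_smul (L : E →L[ℝ] E) : Continuous fun s : ℝ => exp (s • L) :=
  continuous_iff_continuousAt.2 fun t => (hasDerivAt_exp_smul_const L t).continuousAt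

theorem exp_smul_apply_exp_neg_smul (L : E →L[ℝ] E) (t : ℝ) (x : E) :
    exp (t • L) (exp (-t • L) x) = x := by
  have h : exp (t • L) * exp (-t • L) = 1 := by
    let _ : NormedAlgebra ℚ (E →L[ℝ] E) := NormedAlgebra.restrictScalars ℚ ℝ _
    rw [← NormedSpace.exp_add_of_commute, neg_smul, add_neg_cancel, exp_zero]
    exact ((Commute.refl L).smul_left t).smul_right (-t)
  exact congrArg (fun M : E →L[ℝ] E => M x) h

/-- Variation of constants. -/
theorem exists_hasDerivAt_linear (L : E →L[ℝ] E) {f : ℝ → E} (hf : Continuous f) :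
    ∃ x : ℝ → E, x 0 = 0 ∧ ∀ t, HasDerivAt x (L (x t) + f t) t := by
  have hc : Continuous fun s : ℝ => exp (-s • L) (f s) :=
    ((continuous_exp_smul L).comp continuous_neg).clm_apply hf
  refine ⟨fun t => exp (t • L) (∫ s in (0 : ℝ)..t, exp (-s • L) (f s)), by simp, fun t => ?_⟩
  have h := (hasDerivAt_exp_smul_const' L t).clm_apply
    (hc.integral_hasStrictDerivAt 0 t).hasDerivAt
  refine h.congr_deriv ?_
  rw [exp_smul_apply_exp_neg_smul]
  simp

/-- The states that can be reached from the origin in unit time by a continuous input. -/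
def reachableSubmodule {F : Type*} [NormedAddCommGroup F] [NormedSpace ℝ F]
    (L : E →L[ℝ] E) (K : F →L[ℝ] E) : Submodule ℝ E where
  carrier := {y | ∃ (u : ℝ → F) (x : ℝ → E), Continuous u ∧ x 0 = 0 ∧ x 1 = y ∧
    ∀ t, HasDerivAt x (L (x t) + K (u t)) t}
  zero_mem' := ⟨0, 0, continuous_zero, rfl, rfl, fun t => by simp⟩
  add_mem' := by
    rintro _ _ ⟨u, x, hu, hx, rfl, h⟩ ⟨u', x', hu', hx', rfl, h'⟩
    refine ⟨u + u', x + x', hu.add hu', by simp [hx, hx'], rfl, fun t => ?_⟩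
    refine ((h t).add (h' t)).congr_deriv ?_
    simp only [Pi.add_apply, map_add]
    abel
  smul_mem' := by
    rintro c _ ⟨u, x, hu, hx, rfl, h⟩
    refine ⟨c • u, c • x, hu.const_smul c, by simp [hx], rfl, fun t => ?_⟩
    refine ((h t).const_smul c).congr_deriv ?_
    simp

end Kalman

-- A functional φ vanishing on all states reachable in unit time is tested against the input it
-- induces itself; this forces φ e^{(1-t)A} B = 0 on (0, 1), and Kalman's condition then gives φ =
-- 0.
open NormedSpace in
theorem controllable_of_kalman {d m : ℕ} {A : Matrix (Fin d) (Fin d) ℝ}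
    {B : Matrix (Fin d) (Fin m) ℝ} (h : ∀ w : Fin d → ℝ, (∀ k : ℕ, w ᵥ* (A ^ k * B) = 0) → w = 0) :
    Controllable A B := by
  set L : (Fin d → ℝ) →L[ℝ] (Fin d → ℝ) := LinearMap.toContinuousLinearMap A.mulVecLin with hL
  set K : (Fin m → ℝ) →L[ℝ] (Fin d → ℝ) := LinearMap.toContinuousLinearMap B.mulVecLin with hK
  have hLA : ∀ x, L x = A *ᵥ x := fun _ => rfl
  have hKB : ∀ x, K x = B *ᵥ x := fun _ => rfl
  have htop : reachableSubmodule L K = ⊤ := by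
    by_contra hne
    obtain ⟨g, hg0, hg⟩ := Submodule.exists_le_ker_of_lt_top _ (lt_top_iff_ne_top.2 hne)
    set φ : (Fin d → ℝ) →L[ℝ] ℝ := LinearMap.toContinuousLinearMap g with hφ
    -- `p t` is the costate, `u` the input it induces.
    let p : ℝ → (Fin d → ℝ) → ℝ := fun t x => φ (exp ((1 - t) • L) x)
    let u : ℝ → Fin m → ℝ := fun t j => p t (K (Pi.single j 1))
    have hp : ∀ x t, HasDerivAt (fun s => p s x) (-p t (L x)) t := by
      intro x t
      have h₁ := ((hasDerivAt_exp_smul_const L (1 - t)).scomp t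
        ((hasDerivAt_id t).const_sub 1)).clm_apply (hasDerivAt_const t x)
      have h₂ := φ.hasFDerivAt.comp_hasDerivAt t h₁
      refine h₂.congr_deriv ?_
      simp [p]
    have hu : Continuous u :=
      continuous_pi fun j => continuous_iff_continuousAt.2 fun t => (hp _ t).continuousAt
    obtain ⟨x, hx0, hx⟩ := exists_hasDerivAt_linear L (K.continuous.comp hu)
    have hx1 : φ (x 1) = 0 := hg ⟨u, x, hu, hx0, rfl, hx⟩
    have hpK : ∀ t, p t (K (u t)) = ∑ j, u t j ^ 2 := by
      intro t
      have : K (u t) = ∑ j, u t j • K (Pi.single j 1) := by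
        conv_lhs => rw [pi_eq_sum_univ' (u t)]
        simp [map_sum]
      simp only [p] at *
      rw [this]
      simp only [map_sum, map_smul, smul_eq_mul]
      exact Finset.sum_congr rfl fun j _ => by simp [u, p, sq]
    have hpx : ∀ t, HasDerivAt (fun s => p s (x s)) (∑ j, u t j ^ 2) t := by
      intro t
      have h₁ := ((hasDerivAt_exp_smul_const L (1 - t)).scomp t
        ((hasDerivAt_id t).const_sub 1)).clm_apply (hx t)
      have h₂ := φ.hasFDerivAt.comp_hasDerivAt t h₁
      refine h₂.congr_deriv ?_
      rw [← hpK]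
      simp [p]
    -- The drift terms cancel in `hpx`, so the pairing of costate and state has derivative |u|². It
    -- vanishes at both ends, hence is constant, and u = 0 in between.
    have hmono : Monotone fun s => p s (x s) :=
      monotone_of_hasDerivAt_nonneg hpx fun t => Finset.sum_nonneg fun j _ => sq_nonneg _
    have h0 : p 0 (x 0) = 0 := by simp [p, hx0]
    have h1 : p 1 (x 1) = 0 := by simp [p, hx1]
    have hu0 : ∀ t ∈ Set.Ioo (0 : ℝ) 1, ∀ j, u t j = 0 := by
      intro t ht j
      have hz : (fun s => p s (x s)) =ᶠ[nhds t] fun _ => 0 := by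
        filter_upwards [Ioo_mem_nhds ht.1 ht.2] with s hs
        exact le_antisymm ((hmono hs.2.le).trans h1.le) (h0.ge.trans (hmono hs.1.le))
      have := (hpx t).unique ((hasDerivAt_const t (0 : ℝ)).congr_of_eventuallyEq hz)
      have := (Finset.sum_eq_zero_iff_of_nonneg fun j _ => sq_nonneg _).1 this j (Finset.mem_univ j)
      exact pow_eq_zero_iff two_ne_zero |>.1 this
    -- Each differentiation in t of the vanishing function brings down one more factor `A`.
    have hk : ∀ (k : ℕ), ∀ t ∈ Set.Ioo (0 : ℝ) 1, ∀ j,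
        p t ((A ^ k) *ᵥ (B *ᵥ Pi.single j 1)) = 0 := by
      intro k
      induction k with
      | zero => intro t ht j; rw [pow_zero, one_mulVec]; exact hu0 t ht j
      | succ k ih =>
        intro t ht j
        have hz : (fun s => p s ((A ^ k) *ᵥ (B *ᵥ Pi.single j 1))) =ᶠ[nhds t] fun _ => 0 := by
          filter_upwards [Ioo_mem_nhds ht.1 ht.2] with s hs using ih s hs j
        have := (hp _ t).unique ((hasDerivAt_const t (0 : ℝ)).congr_of_eventuallyEq hz)
        rw [hLA, mulVec_mulVec, ← pow_succ'] at this
        simpa using this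
    have hw := h (fun i => p (1 / 2) (Pi.single i 1)) (by
      intro k
      ext j
      have := hk k (1 / 2) (by norm_num) j
      rw [mulVec_mulVec, pi_eq_sum_univ' ((A ^ k * B) *ᵥ Pi.single j 1)] at this
      simp only [p, map_sum, map_smul, smul_eq_mul] at this
      simp only [vecMul, dotProduct, Pi.zero_apply, p]
      refine Eq.trans ?_ this
      exact Finset.sum_congr rfl fun i _ => by simp [mul_comm])
    have hp0 : ∀ x, p (1 / 2) x = 0 := by
      intro x
      rw [pi_eq_sum_univ' x]
      simp only [p, map_sum, map_smul, smul_eq_mul]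
      exact Finset.sum_eq_zero fun i _ => by
        have := congrFun hw i
        simp only [p, Pi.zero_apply] at this
        rw [this, mul_zero]
    apply hg0
    ext1 y
    have := hp0 (exp (-(1 - 1 / 2 : ℝ) • L) (Pi.single y 1))
    simp only [p] at this
    rw [exp_smul_apply_exp_neg_smul] at this
    ext
    simpa [hφ] using this
  intro x₀ x₁
  -- By superposition, the input only has to supply the difference between the target and the free
  -- evolution of `x₀`.
  obtain ⟨u, x, hu, hx0, hx1, hx⟩ : x₁ - exp ((1 : ℝ) • L) x₀ ∈ reachableSubmodule L K := by
    rw [htop]; trivial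
  refine ⟨1, one_pos, u, fun t => exp (t • L) x₀ + x t, hu.continuousOn, fun t _ => ?_, ?_, ?_⟩
  · refine (((hasDerivAt_exp_smul_apply L x₀ t).add (hx t)).congr_deriv ?_).hasDerivWithinAt
    rw [← hLA, ← hKB, map_add]
    abel
  · simp [hx0]
  · simp [hx1]

end StructuralControl
-- Cycle forests and their controllable realization.
namespace StructuralControl

open Matrix Relation Equiv.Perm

section Cycles

variable {V : Type*} [Finite V] {σ : Equiv.Perm V} {v : V → ℂ} {r : ℝ} {μ : ℂ}

/-- Iterating the recurrence `orderOf σ` times returns to `k` and gives rⁿ = μⁿ. -/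
theorem norm_eq_of_forall_sameCycle (hr : 0 < r) {k : V} (hk : v k ≠ 0)
    (h : ∀ j, σ.SameCycle k j → r * v (σ j) = μ * v j) : ‖μ‖ = r := by
  have hpow : ∀ n : ℕ, (r : ℂ) ^ n * v ((σ ^ n) k) = μ ^ n * v k := by
    intro n
    induction n with
    | zero => simp
    | succ n ih =>
      have := h ((σ ^ n) k) ⟨n, by simp⟩
      rw [pow_succ, pow_succ' σ, Equiv.Perm.mul_apply, mul_assoc, this, mul_left_comm, ih]
      ring
  have hn : orderOf σ ≠ 0 := (orderOf_pos σ).ne'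
  have := hpow (orderOf σ)
  rw [pow_orderOf_eq_one, Equiv.Perm.one_apply] at this
  have := congrArg norm (mul_right_cancel₀ hk this)
  rw [norm_pow, norm_pow, Complex.norm_real, Real.norm_of_nonneg hr.le] at this
  exact ((pow_left_inj₀ hr.le (norm_nonneg μ) hn).1 this).symm

/-- A zero propagates forward along σ until `j₀`, and from `j₀` backward around the whole cycle;
neither direction uses the recurrence at `j₀`. -/
theorem eq_zero_of_forall_sameCycle_ne (hr : r ≠ 0) (hμ : μ ≠ 0) {j₀ : V}
    (h : ∀ j, σ.SameCycle j₀ j → j ≠ j₀ → r * v (σ j) = μ * v j)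
    {j₁ : V} (hj₁ : σ.SameCycle j₀ j₁) (hv : v j₁ = 0) {j : V} (hj : σ.SameCycle j₀ j) :
    v j = 0 := by
  have forward : ∀ (n : ℕ) (j : V), σ.SameCycle j₀ j → v j = 0 → (σ ^ n) j = j₀ → v j₀ = 0 := by
    intro n
    induction n with
    | zero => rintro j - hv rfl; simpa using hv
    | succ n ih =>
      intro j hs hj hn
      by_cases hjj : j = j₀
      · rwa [← hjj]
      · refine ih (σ j) (sameCycle_apply_right.2 hs) ?_ (by rwa [pow_succ] at hn)
        have := h j hs hjj
        rw [hj, mul_zero] at this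
        exact (mul_eq_zero.1 this).resolve_left (by exact_mod_cast hr)
  obtain ⟨n, hn⟩ := hj₁.symm.exists_nat_pow_eq
  have h₀ : v j₀ = 0 := forward n j₁ hj₁ hv hn
  have backward : ∀ (n : ℕ) (j : V), (σ ^ n) j = j₀ → v j = 0 := by
    intro n
    induction n with
    | zero => rintro j rfl; simpa using h₀
    | succ n ih =>
      intro j hn
      by_cases hjj : j = j₀
      · rwa [hjj]
      · have := h j (SameCycle.symm ⟨(n + 1 : ℕ), by rwa [zpow_natCast]⟩) hjj
        rw [ih (σ j) (by rwa [pow_succ] at hn), mul_zero] at this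
        exact (mul_eq_zero.1 this.symm).resolve_left hμ
  obtain ⟨n, hn⟩ := hj.symm.exists_nat_pow_eq
  exact backward n j hn

end Cycles

/-- A forest of cycles: `head` picks a vertex in each cycle of `σ`, and the head of each cycle
receives one arc, either from a cycle of smaller rank or from an input. -/
structure CycleForest (d m : ℕ) where
  σ : Equiv.Perm (Fin d)
  head : Fin d → Fin d
  rank : Fin d → ℕ
  source : Fin d → Fin d ⊕ Fin m
  head_perm : ∀ j, head (σ j) = head j
  sameCycle_head : ∀ j, σ.SameCycle (head j) j
  rank_head : ∀ j, rank (head j) = rank j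
  rank_lt : ∀ i j, source i = Sum.inl j → rank j < rank i

namespace CycleForest

variable {d m : ℕ} (F : CycleForest d m)

open Classical in
/-- The state matrix of a cycle forest: the cycles get pairwise distinct positive weights. -/
noncomputable def stateMatrix : Matrix (Fin d) (Fin d) ℝ := fun i j =>
  (if i = F.σ j then ((F.head j : ℕ) + 1 : ℝ) else 0) +
    (if F.head i = i ∧ F.source i = Sum.inl j then 1 else 0)

open Classical in
/-- The input matrix of a cycle forest. -/
noncomputable def inputMatrix : Matrix (Fin d) (Fin m) ℝ := fun i u =>
  if F.head i = i ∧ F.source i = Sum.inr u then 1 else 0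

theorem head_eq_of_sameCycle {j k : Fin d} (h : F.σ.SameCycle j k) : F.head j = F.head k := by
  obtain ⟨n, rfl⟩ := h.exists_nat_pow_eq
  induction n with
  | zero => simp
  | succ n ih =>
    rw [pow_succ', Equiv.Perm.mul_apply, F.head_perm]
    exact ih ⟨n, by simp⟩

theorem head_head (j : Fin d) : F.head (F.head j) = F.head j :=
  F.head_eq_of_sameCycle (F.sameCycle_head j)

theorem sameCycle_of_head_eq {j k : Fin d} (h : F.head j = F.head k) : F.σ.SameCycle j k :=
  (F.sameCycle_head j).symm.trans (h ▸ F.sameCycle_head k)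

/-- `F.Parent i p`: the cycle with head `i` receives its arc from the cycle with head `p`. -/
def Parent (i p : Fin d) : Prop := ∃ j, F.source i = Sum.inl j ∧ p = F.head j

theorem parent_rightUnique : Relator.RightUnique F.Parent := by
  rintro i _ _ ⟨j, hj, rfl⟩ ⟨j', hj', rfl⟩
  rw [Sum.inl_injective (hj.symm.trans hj')]

variable {F}

theorem Parent.rank_lt {i p : Fin d} (h : F.Parent i p) : F.rank p < F.rank i := by
  obtain ⟨j, hj, rfl⟩ := h
  rw [F.rank_head]
  exact F.rank_lt i j hj

theorem rank_le_of_reflTransGen {i p : Fin d} (h : ReflTransGen F.Parent i p) :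
    F.rank p ≤ F.rank i := by
  induction h with
  | refl => exact le_rfl
  | tail _ h ih => exact h.rank_lt.le.trans ih

theorem eq_of_parent_of_reflTransGen {i i' p : Fin d} (hi : F.Parent i p) (hi' : F.Parent i' p)
    (h : ReflTransGen F.Parent i i') : i = i' := by
  obtain rfl | ⟨q, hq, hqi⟩ := h.cases_head
  · rfl
  · rw [F.parent_rightUnique hq hi] at hqi
    exact absurd (rank_le_of_reflTransGen hqi) hi'.rank_lt.not_ge

/-- Parents are unique, so the ancestors of `k` form a chain of strictly decreasing rank; within it
each cycle has at most one child. -/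
theorem eq_of_parent_of_ancestors {k i i' p : Fin d} (hki : ReflTransGen F.Parent k i)
    (hki' : ReflTransGen F.Parent k i') (hi : F.Parent i p) (hi' : F.Parent i' p) : i = i' := by
  rcases ReflTransGen.total_of_right_unique F.parent_rightUnique hki hki' with h | h
  · exact eq_of_parent_of_reflTransGen hi hi' h
  · exact (eq_of_parent_of_reflTransGen hi' hi h).symm

variable (F)

-- The support of a left eigenvector killed by the input matrix would lie on a single chain of
-- ancestor cycles, because distinct weights allow only one cycle to satisfy |μ| = weight.
-- Nonvanishing then climbs this chain to its root, where the input column contradicts it.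
open Classical in
theorem hautus (μ : ℂ) (v : Fin d → ℂ)
    (hA : v ᵥ* F.stateMatrix.map Complex.ofReal = μ • v)
    (hB : v ᵥ* F.inputMatrix.map Complex.ofReal = 0) : v = 0 := by
  have hstate : ∀ j, (((F.head j : ℕ) + 1 : ℝ) : ℂ) * v (F.σ j) +
      ∑ i, (if F.head i = i ∧ F.source i = Sum.inl j then v i else 0) = μ * v j := by
    intro j
    have := congrFun hA j
    simp only [vecMul, dotProduct, Matrix.map_apply, stateMatrix, Pi.smul_apply,
      smul_eq_mul] at this
    rw [← this]
    simp only [Complex.ofReal_add, mul_add, Finset.sum_add_distrib]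
    congr 1
    · rw [Finset.sum_eq_single (F.σ j)]
      · simp [mul_comm]
      · intro i _ hi; simp [hi]
      · simp
    · exact Finset.sum_congr rfl fun i _ => by split_ifs <;> simp
  have hinput : ∀ u, ∑ i, (if F.head i = i ∧ F.source i = Sum.inr u then v i else 0) = 0 := by
    intro u
    have := congrFun hB u
    simp only [vecMul, dotProduct, Matrix.map_apply, inputMatrix, Pi.zero_apply] at this
    refine Eq.trans ?_ this
    exact Finset.sum_congr rfl fun i _ => by split_ifs <;> simp
  have hcycle : ∀ j, (∀ i, F.head i = i → F.source i = Sum.inl j → v i = 0) →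
      (((F.head j : ℕ) + 1 : ℝ) : ℂ) * v (F.σ j) = μ * v j := by
    intro j hj
    rw [← hstate j, Finset.sum_eq_zero, add_zero]
    intro i _
    split_ifs with h
    · exact hj i h.1 h.2
    · rfl
  by_contra hv
  obtain ⟨k, hk, hmax⟩ := Set.Finite.exists_maximalFor F.rank {k | v k ≠ 0} (Set.toFinite _)
    (Function.ne_iff.1 hv)
  have hpos : ∀ k, (0 : ℝ) < (F.head k : ℕ) + 1 := fun k => by positivity
  have hmax' : ∀ i, F.rank k < F.rank i → v i = 0 := fun i hi => by
    by_contra hvi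
    exact absurd (hmax hvi hi.le) hi.not_ge
  have hrank : ∀ {j k}, F.σ.SameCycle k j → F.rank j = F.rank k := fun {j k} h => by
    rw [← F.rank_head j, ← F.rank_head k, F.head_eq_of_sameCycle h]
  have hkcycle : ∀ j, F.σ.SameCycle k j →
      (((F.head k : ℕ) + 1 : ℝ) : ℂ) * v (F.σ j) = μ * v j := fun j hj => by
    -- Arcs leaving the cycle of `k` enter cycles of larger rank, where `v` vanishes, so the
    -- recurrence on this cycle is homogeneous.
    rw [F.head_eq_of_sameCycle hj]
    exact hcycle j fun i _ hs => hmax' i (by rw [← hrank hj]; exact F.rank_lt i j hs)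
  have hnorm : ‖μ‖ = (F.head k : ℕ) + 1 := norm_eq_of_forall_sameCycle (hpos k) hk hkcycle
  have hμ : μ ≠ 0 := norm_pos_iff.1 (hnorm ▸ hpos k)
  -- Take a counterexample of maximal rank. A child cycle with nonzero head entry would be an
  -- ancestor of `k`, making this cycle one too; so there is none, the recurrence is homogeneous,
  -- and its weight equals |μ|, the weight of the cycle of `k`.
  have hanc : ∀ l, v l ≠ 0 → ReflTransGen F.Parent (F.head k) (F.head l) := by
    by_contra! hcon
    obtain ⟨l, ⟨hl, hnot⟩, hlmax⟩ := Set.Finite.exists_maximalFor F.rank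
      {l | v l ≠ 0 ∧ ¬ ReflTransGen F.Parent (F.head k) (F.head l)} (Set.toFinite _) hcon
    have hl' : ‖μ‖ = (F.head l : ℕ) + 1 := by
      refine norm_eq_of_forall_sameCycle (σ := F.σ) (hpos l) hl fun j hj => ?_
      rw [F.head_eq_of_sameCycle hj]
      refine hcycle j fun i hi hs => ?_
      by_contra hvi
      have hlt : F.rank l < F.rank i := by rw [← hrank hj]; exact F.rank_lt i j hs
      refine absurd (hlmax ⟨hvi, fun hki => hnot ?_⟩ hlt.le) hlt.not_ge
      rw [hi] at hki
      exact hki.tail ⟨j, hs, F.head_eq_of_sameCycle hj⟩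
    have : F.head k = F.head l := by
      have := hnorm.symm.trans hl'
      exact Fin.ext (by exact_mod_cast add_right_cancel this)
    exact hnot (this ▸ .refl)
  have hne : ∀ p, ReflTransGen F.Parent (F.head k) p →
      F.head p = p ∧ ∀ j, F.head j = p → v j ≠ 0 := by
    intro p hp
    induction hp with
    | refl =>
      refine ⟨F.head_head k, fun j hj hvj => hk ?_⟩
      exact eq_zero_of_forall_sameCycle_ne (hpos k).ne' hμ (fun j hj _ => hkcycle j hj)
        (F.sameCycle_of_head_eq hj.symm) hvj (SameCycle.refl _ _)
    | @tail i p hi hip ih =>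
      obtain ⟨j₀, hs₀, rfl⟩ := id hip
      refine ⟨F.head_head j₀, fun j hj hvj => ih.2 i ih.1 ?_⟩
      -- The only arc from this cycle to a nonzero entry goes from `j₀` to `i`. A zero on the cycle
      -- would therefore spread over all of it, and the equation at `j₀` would reduce to v i = 0.
      have huniq : ∀ j', F.σ.SameCycle j₀ j' → ∀ i', F.head i' = i' → F.source i' = Sum.inl j' →
          v i' ≠ 0 → i' = i := fun j' hj' i' hi' hs' hv' => by
        have h₁ := hanc i' hv'
        rw [hi'] at h₁
        exact eq_of_parent_of_ancestors h₁ hi ⟨j', hs', F.head_eq_of_sameCycle hj'⟩ hip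
      have hzero : ∀ j', F.σ.SameCycle j₀ j' → v j' = 0 := fun j' hj' => by
        refine eq_zero_of_forall_sameCycle_ne (hpos j₀).ne' hμ (fun l hl hne => ?_)
          (F.sameCycle_of_head_eq hj.symm) hvj hj'
        rw [F.head_eq_of_sameCycle hl]
        refine hcycle l fun i' hi' hs' => ?_
        by_contra hv'
        rw [huniq l hl i' hi' hs' hv', hs₀] at hs'
        exact hne (Sum.inl_injective hs').symm
      have := hstate j₀
      rw [hzero _ (SameCycle.refl _ _), hzero _ (sameCycle_apply_right.2 (SameCycle.refl _ _)),
        mul_zero, mul_zero, zero_add, Finset.sum_eq_single i] at this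
      · simpa [ih.1, hs₀] using this
      · intro i' _ hi'
        split_ifs with hc
        · by_contra hv'
          exact hi' (huniq j₀ (SameCycle.refl _ _) i' hc.1 hc.2 hv')
        · rfl
      · simp
  -- The root of the chain is fed by an input `u`. Even if `u` feeds other cycles, the root is the
  -- only one of them in the support, so column `u` forces its entry to vanish.
  obtain ⟨i, hi, hmin⟩ := Set.Finite.exists_minimalFor F.rank
    {i | ReflTransGen F.Parent (F.head k) i} (Set.toFinite _) ⟨_, .refl⟩
  have hend : ∀ p, ¬ F.Parent i p := fun p hp =>
    absurd (hmin (hi.tail hp) hp.rank_lt.le) hp.rank_lt.not_ge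
  rcases hs : F.source i with j | u
  · exact hend _ ⟨j, hs, rfl⟩
  · have := hinput u
    rw [Finset.sum_eq_single i] at this
    · exact (hne i hi).2 i (hne i hi).1 (by simpa [(hne i hi).1, hs] using this)
    · intro i' _ hi'
      split_ifs with hc
      · by_contra hv'
        have h₁ := hanc i' hv'
        rw [hc.1] at h₁
        rcases ReflTransGen.total_of_right_unique F.parent_rightUnique hi h₁ with h | h
        · obtain rfl | ⟨q, hq, -⟩ := h.cases_head
          · exact hi' rfl
          · exact hend q hq
        · obtain rfl | ⟨q, ⟨j, hj, -⟩, -⟩ := h.cases_head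
          · exact hi' rfl
          · simp [hc.2] at hj
      · rfl
    · simp

theorem controllable : Controllable F.stateMatrix F.inputMatrix :=
  controllable_of_kalman (kalman_of_hautus F.hautus)

end CycleForest

/-! ### Structural controllability from input reachability and a perfect matching. -/

/-- Vertices at the end of a walk with `n` arcs that starts at a vertex receiving an input. -/
def InputLevel {d m : ℕ} (A : SparsityMatrix d d) (B : SparsityMatrix d m) : ℕ → Fin d → Prop
  | 0, i => ∃ u, B i u ≠ 0
  | n + 1, i => ∃ j, A i j ≠ 0 ∧ InputLevel A B n j

/-- Let δ be the distance from the inputs. The head of a cycle is a vertex minimizing δ, its rank is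
that minimum, and its source is the preceding vertex (or input) on a shortest walk; that vertex has
smaller δ, so its cycle has smaller rank. -/
theorem exists_cycleForest {d m : ℕ} {A : SparsityMatrix d d} {B : SparsityMatrix d m}
    (σ : Equiv.Perm (Fin d)) (h : ∀ i, ∃ n, InputLevel A B n i) :
    ∃ F : CycleForest d m, F.σ = σ ∧
      (∀ i j, F.head i = i → F.source i = Sum.inl j → A i j ≠ 0) ∧
      (∀ i u, F.head i = i → F.source i = Sum.inr u → B i u ≠ 0) := by
  classical
  let δ : Fin d → ℕ := fun i => Nat.find (h i)
  have hδ : ∀ i, ∃ s : Fin d ⊕ Fin m, (∀ j, s = Sum.inl j → A i j ≠ 0 ∧ δ j < δ i) ∧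
      (∀ u, s = Sum.inr u → B i u ≠ 0) := by
    intro i
    have hi : InputLevel A B (δ i) i := Nat.find_spec (h i)
    rcases hn : δ i with _ | n
    · rw [hn] at hi
      obtain ⟨u, hu⟩ := hi
      exact ⟨Sum.inr u, by simp, fun u' h => by cases h; exact hu⟩
    · rw [hn] at hi
      obtain ⟨j, hj, hl⟩ := hi
      refine ⟨Sum.inl j, fun j' h => ?_, by simp⟩
      cases h
      exact ⟨hj, Nat.lt_succ_of_le (Nat.find_min' _ hl)⟩
  choose s hsA hsB using hδ
  have hq : ∀ q : Quotient (SameCycle.setoid σ), ∃ k, Quotient.mk _ k = q ∧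
      ∀ k', Quotient.mk _ k' = q → δ k ≤ δ k' := by
    intro q
    obtain ⟨k, hk, hmin⟩ := Set.Finite.exists_minimalFor δ
      {k | Quotient.mk (SameCycle.setoid σ) k = q} (Set.toFinite _) q.exists_rep
    refine ⟨k, hk, fun k' hk' => ?_⟩
    by_contra! hlt
    exact absurd (hmin hk' hlt.le) hlt.not_ge
  choose g hg hmin using hq
  let head : Fin d → Fin d := fun j => g (Quotient.mk _ j)
  have hhead : ∀ j, σ.SameCycle (head j) j := fun j => Quotient.exact (hg (Quotient.mk _ j))
  have hcongr : ∀ {j k}, σ.SameCycle j k → head j = head k := fun {j k} hjk =>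
    congrArg g (Quotient.sound (s := SameCycle.setoid σ) hjk)
  refine ⟨⟨σ, head, fun j => δ (head j), fun i => s (head i),
    fun j => hcongr (sameCycle_apply_left.2 (SameCycle.refl _ _)), hhead,
    fun j => by rw [hcongr (hhead j)], fun i j hs => ?_⟩, rfl, fun i j hi hs => ?_,
    fun i u hi hs => ?_⟩
  · exact (hmin _ j rfl).trans_lt (hsA _ j hs).2
  · have := (hsA _ j hs).1
    simp only at hi
    rwa [hi] at this
  · have := hsB _ u hs
    simp only at hi
    rwa [hi] at this

theorem structurallyControllable_of_inputLevel {d m : ℕ} {A : SparsityMatrix d d}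
    {B : SparsityMatrix d m} (hA : HasPerfectMatching A) (h : ∀ i, ∃ n, InputLevel A B n i) :
    StructurallyControllable A B := by
  obtain ⟨σ, hσ⟩ := exists_perm_of_hasPerfectMatching hA
  obtain ⟨F, rfl, hFA, hFB⟩ := exists_cycleForest σ h
  refine ⟨F.stateMatrix, F.inputMatrix, fun i j hij => ?_, fun i u hiu => ?_, F.controllable⟩
  · have h₁ : i ≠ F.σ j := by
      rintro rfl
      exact hσ j hij
    have h₂ : ¬ (F.head i = i ∧ F.source i = Sum.inl j) := fun hc => hFA i j hc.1 hc.2 hij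
    simp [CycleForest.stateMatrix, h₁, h₂]
  · have h₂ : ¬ (F.head i = i ∧ F.source i = Sum.inr u) := fun hc => hFB i u hc.1 hc.2 hiu
    simp [CycleForest.inputMatrix, h₂]

theorem structurallyControllable_of_isSSCC {d m : ℕ} {A : SparsityMatrix d d}
    {B : SparsityMatrix d m} (hA : HasPerfectMatching A)
    (h : ∀ S, IsSSCC (stateDigraph A) S → ∃ i ∈ S, ∃ u, B i u ≠ 0) :
    StructurallyControllable A B := by
  refine structurallyControllable_of_inputLevel hA fun i => ?_
  obtain ⟨S, hS, hreach⟩ := exists_isSSCC_reachable (stateDigraph A) i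
  obtain ⟨j, hj, hu⟩ := h S hS
  have hji := hreach j hj
  induction hji with
  | refl => exact ⟨0, hu⟩
  | tail _ hkl ih =>
    obtain ⟨n, hn⟩ := ih fun w hw => by
      exact (hS.1.1.reachable hw hj).trans ‹_›
    exact ⟨n + 1, _, hkl, hn⟩

end StructuralControl
-- Necessity of an input in each source component, and the count.
namespace StructuralControl

open Matrix

/-- If no arc and no input enters `S`, the states in `S` stay at zero, whatever the input. -/
theorem not_controllable_of_forall_zero {d m : ℕ} {A : Matrix (Fin d) (Fin d) ℝ}
    {B : Matrix (Fin d) (Fin m) ℝ} {S : Set (Fin d)} (hS : S.Nonempty)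
    (hA : ∀ i ∈ S, ∀ j ∉ S, A i j = 0) (hB : ∀ i ∈ S, ∀ u, B i u = 0) : ¬ Controllable A B := by
  classical
  intro hc
  -- The target `1` is the all-ones vector, nonzero at every coordinate of `S`. The trajectory
  -- truncated to `S` solves an autonomous linear equation from 0, so uniqueness keeps it at 0.
  obtain ⟨T, hT, u, x, -, hx, hx0, hxT⟩ := hc 0 1
  obtain ⟨i, hi⟩ := hS
  let y : ℝ → Fin d → ℝ := fun t k => if k ∈ S then x t k else 0
  have hy : ∀ t ∈ Set.Icc 0 T, HasDerivWithinAt y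
      (fun k => if k ∈ S then (A *ᵥ y t) k else 0) (Set.Icc 0 T) t := by
    intro t ht
    rw [hasDerivWithinAt_pi]
    intro k
    by_cases hk : k ∈ S
    · simp only [y, hk, if_true]
      refine ((hasDerivWithinAt_pi.1 (hx t ht)) k).congr_deriv ?_
      have h₁ : (B *ᵥ u t) k = 0 := by simp [mulVec, dotProduct, hB k hk]
      rw [Pi.add_apply, h₁, add_zero]
      simp only [mulVec, dotProduct]
      refine Finset.sum_congr rfl fun j _ => ?_
      by_cases hj : j ∈ S
      · simp [hj]
      · simp [hA k hk j hj]
    · simp only [y, hk, if_false]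
      exact hasDerivWithinAt_const _ _ _
  let P : (Fin d → ℝ) →ₗ[ℝ] (Fin d → ℝ) :=
    (LinearMap.pi fun k =>
      if k ∈ S then (LinearMap.proj k : (Fin d → ℝ) →ₗ[ℝ] ℝ) else 0) ∘ₗ A.mulVecLin
  have hP : ∀ w, P w = fun k => if k ∈ S then (A *ᵥ w) k else 0 := by
    intro w
    ext k
    by_cases hk : k ∈ S <;> simp [P, hk]
  have huniq : Set.EqOn y 0 (Set.Icc 0 T) := by
    refine ODE_solution_unique (v := fun _ => P) (K := ‖P.toContinuousLinearMap‖₊)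
      (fun _ => P.toContinuousLinearMap.lipschitz)
      (fun t ht => (hy t ht).continuousWithinAt) (fun t ht => ?_)
      continuousOn_const (fun t _ => ?_) ?_
    · rw [hP]
      exact (hy t ⟨ht.1, ht.2.le⟩).mono_of_mem_nhdsWithin (Icc_mem_nhdsGE_of_mem ht)
    · exact (hasDerivWithinAt_const t (Set.Ici t) (0 : Fin d → ℝ)).congr_deriv (by simp)
    · ext k
      simp [y, hx0]
  have := congrFun (huniq (Set.right_mem_Icc.2 hT.le)) i
  simp [y, hi, hxT] at this

theorem StructurallyControllable.exists_input {d m : ℕ} {A : SparsityMatrix d d}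
    {B : SparsityMatrix d m} (h : StructurallyControllable A B) {S : Set (Fin d)}
    (hS : IsSSCC (stateDigraph A) S) : ∃ i ∈ S, ∃ u, B i u ≠ 0 := by
  by_contra! hcon
  obtain ⟨A', B', hA', hB', hc⟩ := h
  refine not_controllable_of_forall_zero hS.1.1.1 (fun i hi j hj => hA' i j ?_)
    (fun i hi u => hB' i u (hcon i hi u)) hc
  by_contra hij
  exact hj (hS.mem_of_adj hi hij)

/-- Under the matching condition, the sparsest admissible input matrix has as many nonzero entries
as there are source strongly connected components. -/
theorem nnz_eq_numSSCC {d m : ℕ} {A : SparsityMatrix d d} {B Bstar : SparsityMatrix d m}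
    (hA : HasPerfectMatching A) (hB : SolvesSparsest A B Bstar) :
    nnz Bstar = numSSCC (stateDigraph A) := by
  classical
  obtain ⟨⟨hzero, hctrl⟩, hmin⟩ := hB
  have hpick : ∀ S : {S | IsSSCC (stateDigraph A) S},
      ∃ p : Fin d × Fin m, p.1 ∈ (S : Set (Fin d)) ∧ Bstar p.1 p.2 ≠ 0 := fun S => by
    obtain ⟨i, hi, u, hu⟩ := hctrl.exists_input S.2
    exact ⟨(i, u), hi, hu⟩
  choose f hfS hfB using hpick
  have hinj : Function.Injective f := fun S T hST =>
    Subtype.ext (S.2.1.eq_of_mem T.2.1 (hfS S) (hST ▸ hfS T))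
  have hcard : (Set.range f).ncard = numSSCC (stateDigraph A) := by
    rw [← Nat.card_coe_set_eq, Nat.card_range_of_injective hinj, Nat.card_coe_set_eq, numSSCC]
  have hfree : Entry.free ≠ 0 := fun h => Entry.noConfusion h
  -- `N` keeps exactly the chosen entries of `Bstar`, so it inherits the fixed zeros of `B` and
  -- still feeds every source component.
  let N : SparsityMatrix d m := fun i u => if (i, u) ∈ Set.range f then Entry.free else 0
  have hN : ∀ i u, N i u ≠ 0 ↔ (i, u) ∈ Set.range f := fun i u => by
    by_cases h : (i, u) ∈ Set.range f
    · exact iff_of_true ((if_pos h).trans_ne hfree) h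
    · exact iff_of_false (fun hne => hne (if_neg h)) h
  have hnnz : nnz N = (Set.range f).ncard := congrArg Set.ncard (Set.ext fun p => hN p.1 p.2)
  refine le_antisymm ?_ ?_
  · rw [← hcard, ← hnnz]
    refine hmin (a := N) ⟨fun p hp => ?_, structurallyControllable_of_isSSCC hA fun S hS => ?_⟩
    · have hp' := hzero hp
      by_contra hne
      obtain ⟨S, hS⟩ := (hN p.1 p.2).1 hne
      exact hfB S (by rw [hS]; exact hp')
    · exact ⟨(f ⟨S, hS⟩).1, hfS ⟨S, hS⟩, (f ⟨S, hS⟩).2, (hN _ _).2 ⟨⟨S, hS⟩, rfl⟩⟩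
  · rw [← hcard]
    refine Set.ncard_le_ncard ?_ (Set.toFinite _)
    rintro _ ⟨S, rfl⟩
    exact hfB S

end StructuralControl

theorem mainTheorem7 {d m : ℕ}
    (A : StructuralControl.SparsityMatrix d d) (B : StructuralControl.SparsityMatrix d m)
    (hA : StructuralControl.HasPerfectMatching A)
    (hAB : StructuralControl.StructurallyControllable A B)
    (Bstar : StructuralControl.SparsityMatrix d m)
    (hB : StructuralControl.SolvesSparsest A B Bstar) :
    StructuralControl.nnz Bstar =
      StructuralControl.numSSCC (StructuralControl.stateDigraph A) :=
  StructuralControl.nnz_eq_numSSCC hA hB
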